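/- Let $n\ge 1$ and let $d\ge 2$ be an even integer. Let $\mathcal F_{d,n}$ be the space of real forms (homogeneous polynomials) of degree $d$ in $n$ variables. For $f\in\mathcal F_{d,n}$ let $v(f)\in[0,\infty]$ be the Lebesgue volume of $\{x\in\mathbb R^n: f(x)\le 1\}$. Every $f\in\mathcal F_{d,n}$ can be written as $f(x)=\sum_{k=1}^r\lambda_k\,(y^k\cdot x)^d$ with $r\ge 0$, $\lambda_k\in\mathbb R$ and $y^k\in\mathbb S^{n-1}$, where $\mathbb S^{n-1}$ is the Euclidean unit sphere and $\cdot$ is the dot product. The nuclear norm of $f$ is $$\|f\|_*=\inf\Big\{\sum_{k=1}^r|\lambda_k| :\ f(x)=\sum_{k=1}^r\lambda_k\,(y^k\cdot x)^d,\ r\ge 0,\ \lambda_k\in\mathbb R,\ y^k\in\mathbb S^{n-1}\Big\}.$$ Put $b_{d,n}(x)=(x_1^2+\dots+x_n^2)^{d/2}$ and let $B_n$ be the closed Euclidean unit ball in $\mathbb R^n$, so that $\mathrm{vol}(B_n)=\sqrt{\pi}^{\,n}/\Gamma(\tfrac n2+1)$. Then $b_{d,n}/\|b_{d,n}\|_*$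 belongs to the unit ball of $\|\cdot\|_*$, and for every $f\in\mathcal F_{d,n}$ with $\|f\|_*\le 1$, $$v\!\left(\frac{b_{d,n}}{\|b_{d,n}\|_*}\right)=\left(\prod_{i=0}^{d/2-1}\frac{2i+n}{2i+1}\right)^{n/d}\frac{\sqrt{\pi}^{\,n}}{\Gamma\left(\frac n2+1\right)}\ \le\ v(f),$$ with equality if and only if $f=b_{d,n}/\|b_{d,n}\|_*$. -/

import Mathlib

open MeasureTheory

/-- The value `f(x)` of a polynomial `f` in `n` real variables at a point `x` of Euclidean space. -/
noncomputable def evalForm {n : ℕ} (f : MvPolynomial (Fin n) ℝ)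
    (x : EuclideanSpace ℝ (Fin n)) : ℝ :=
  MvPolynomial.eval (fun i => x i) f

/-- `v(f)`, the Lebesgue volume of the sublevel set `{f ≤ 1}`, a value in `[0, ∞]`. -/
noncomputable def sublevelVolume {n : ℕ} (f : MvPolynomial (Fin n) ℝ) : ENNReal :=
  volume {x : EuclideanSpace ℝ (Fin n) | evalForm f x ≤ 1}

/-- The form `b_{d,n}(x) = (x_1^2 + ... + x_n^2)^{d/2}`, used for even `d`. -/
noncomputable def euclideanForm (d n : ℕ) : MvPolynomial (Fin n) ℝ :=
  (∑ i : Fin n, MvPolynomial.X i ^ 2) ^ (d / 2)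

/-- The set of all sums `∑ |lam_k|` over the decompositions
`f(x) = ∑ lam_k (y^k · x)^d` with real `lam_k` and unit vectors `y^k`. -/
def decompositionCosts {n : ℕ} (d : ℕ) (f : MvPolynomial (Fin n) ℝ) : Set ℝ :=
  {s : ℝ | ∃ (r : ℕ) (lam : Fin r → ℝ) (y : Fin r → EuclideanSpace ℝ (Fin n)),
    (∀ k, ‖y k‖ = 1) ∧
    (∀ x : EuclideanSpace ℝ (Fin n),
      evalForm f x = ∑ k, lam k * (∑ i, y k i * x i) ^ d) ∧
    s = ∑ k, |lam k|}

/-- The nuclear norm of a form `f` of degree `d`. -/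
noncomputable def nuclearNorm {n : ℕ} (d : ℕ) (f : MvPolynomial (Fin n) ℝ) : ℝ :=
  sInf (decompositionCosts d f)

/-- The form `b_{d,n} / ‖b_{d,n}‖_*`. -/
noncomputable def normalizedEuclideanForm (d n : ℕ) : MvPolynomial (Fin n) ℝ :=
  (nuclearNorm d (euclideanForm d n))⁻¹ • euclideanForm d n

/-! Write d = 2m, let c be `sphereMoment n m` and let g = c ‖x‖ ^ d. By rotation invariance (y · x)
^ d has the same integral over a centred ball for every unit vector y, namely that of g. Integration
over a ball is therefore a dual certificate: the integral of f is at most ‖f‖_* times that of g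
(`setIntegral_evalForm_le`). Applied to ‖x‖ ^ d it gives ‖b‖_* ≥ 1 / c. Conversely, averaging (y ·
x) ^ d over y in the unit ball, normalized to total mass one, gives g; by convexity a finite sum
with nonnegative coefficients does the same (`exists_sphereMoment_mul_norm_pow_eq_sum`), so ‖b‖_* ≤
1 / c and g is the normalized form.

For volumes, a form with a negative value has infinite sublevel volume. For a nonnegative f of
finite volume, the layer cake formula gives ∫ max(1 - f, 0) = q v(f), with q > 0 depending only on n
and d. On the ball B = {g ≤ 1}, q v(g) = ∫_B (1 - g) ≤ ∫_B (1 - f) ≤ ∫ max(1 - f, 0) = q v(f).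
Equality forces f ≤ 1 inside B and f ≥ 1 outside, hence f = g by homogeneity
(`volume_sublevel_le_of_setIntegral_le`). -/

open scoped Pointwise

variable {n d m : ℕ}

/-! ### Compactness of convex hulls -/

/-- In a finite-dimensional space the convex hull of a compact set is compact. -/
theorem IsCompact.convexHull_of_finiteDimensional {E : Type*} [NormedAddCommGroup E]
    [NormedSpace ℝ E] [FiniteDimensional ℝ E] {s : Set E} (hs : IsCompact s) :
    IsCompact (convexHull ℝ s) := by
  let D := Module.finrank ℝ E + 1
  let K : Set ((Fin D → ℝ) × (Fin D → E)) := stdSimplex ℝ (Fin D) ×ˢ Set.univ.pi fun _ => s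
  have hK : IsCompact K := (isCompact_stdSimplex ℝ (Fin D)).prod (isCompact_univ_pi fun _ => hs)
  have hF : Continuous fun p : (Fin D → ℝ) × (Fin D → E) => ∑ i, p.1 i • p.2 i := by fun_prop
  convert hK.image hF using 1
  ext x
  constructor
  · intro hx
    obtain ⟨ι, _, z, w, hz, hind, hw, hw1, rfl⟩ := eq_pos_convex_span_of_mem_convexHull hx
    have hcard : Fintype.card ι ≤ Fintype.card (Fin D) := by
      simpa [D] using hind.card_le_finrank_succ
        |>.trans (Nat.add_le_add_right (Submodule.finrank_le _) 1)
    obtain ⟨e⟩ := Function.Embedding.nonempty_of_card_le hcard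
    have : Nonempty ι := by
      by_contra h
      rw [not_nonempty_iff] at h
      simp at hw1
    obtain ⟨i₀⟩ := this
    -- Carathéodory may need fewer than D points; pad with weight zero at `z i₀`, which keeps every
    -- point in s.
    refine ⟨(Function.extend e w 0, Function.extend e z fun _ => z i₀), ⟨⟨?_, ?_⟩, ?_⟩, ?_⟩
    · intro j
      by_cases hj : ∃ i, e i = j
      · obtain ⟨i, rfl⟩ := hj
        simpa [e.injective.extend_apply] using (hw i).le
      · simp [Function.extend_apply' _ _ _ hj]
    · rw [← hw1]
      refine (Fintype.sum_of_injective e e.injective _ _ ?_ ?_).symm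
      · intro j hj
        exact Function.extend_apply' _ _ _ (by simpa using hj)
      · intro i
        simp [e.injective.extend_apply]
    · intro j _
      by_cases hj : ∃ i, e i = j
      · obtain ⟨i, rfl⟩ := hj
        simpa [e.injective.extend_apply] using hz ⟨i, rfl⟩
      · simpa [Function.extend_apply' _ _ _ hj] using hz ⟨i₀, rfl⟩
    · refine (Fintype.sum_of_injective e e.injective _ _ ?_ ?_).symm
      · intro j hj
        simp [Function.extend_apply' w _ _ (show ¬ ∃ i, e i = j by simpa using hj)]
      · intro i
        simp [e.injective.extend_apply]
  · rintro ⟨⟨w, z⟩, ⟨⟨hw, hw1⟩, hz⟩, rfl⟩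
    exact (convex_convexHull ℝ s).sum_mem (fun i _ => hw i) hw1
      fun i _ => subset_convexHull ℝ s (hz i trivial)

/-! ### Existence of decompositions into powers of linear forms -/

/-- The degree `d` monomials evaluated at `y`. -/
def veronese (n d : ℕ) (y : EuclideanSpace ℝ (Fin n)) :
    (Finset.piAntidiag (Finset.univ : Finset (Fin n)) d) → ℝ :=
  fun k => ∏ i, y i ^ k.1 i

/-- The linear functional taking `veronese n d y` to `(y · x) ^ d`. -/
def powerFunctional (n d : ℕ) (x : EuclideanSpace ℝ (Fin n)) :
    ((Finset.piAntidiag (Finset.univ : Finset (Fin n)) d) → ℝ) →ₗ[ℝ] ℝ where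
  toFun t := ∑ k, (Nat.multinomial Finset.univ k.1 : ℝ) * t k * ∏ i, x i ^ k.1 i
  map_add' s t := by simp [mul_add, add_mul, Finset.sum_add_distrib]
  map_smul' c t := by
    simp only [Pi.smul_apply, smul_eq_mul, RingHom.id_apply, Finset.mul_sum]
    exact Finset.sum_congr rfl fun k _ => by ring

theorem powerFunctional_veronese (x y : EuclideanSpace ℝ (Fin n)) :
    powerFunctional n d x (veronese n d y) = (∑ i, y i * x i) ^ d := by
  rw [Finset.sum_pow_eq_sum_piAntidiag, ← Finset.sum_coe_sort]
  refine Finset.sum_congr rfl fun k _ => ?_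
  simp only [veronese, mul_pow, Finset.prod_mul_distrib, mul_assoc]

theorem continuous_veronese : Continuous (veronese n d) := by
  unfold veronese
  fun_prop

/-- A functional φ vanishing on the range gives a polynomial, with coefficients the values of φ on
the basis, that vanishes at every real point; so its coefficients are zero. -/
theorem span_range_veronese : Submodule.span ℝ (Set.range (veronese n d)) = ⊤ := by
  classical
  by_contra h
  obtain ⟨φ, hφ0, hφ⟩ := Submodule.exists_le_ker_of_lt_top _ (lt_top_iff_ne_top.2 h)
  apply hφ0
  let p : MvPolynomial (Fin n) ℝ :=
    ∑ k : (Finset.piAntidiag (Finset.univ : Finset (Fin n)) d),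
      MvPolynomial.monomial (Finsupp.equivFunOnFinite.symm k.1) (φ (Pi.single k 1))
  have hp : p = 0 := by
    apply MvPolynomial.funext
    intro y
    have hy : φ (veronese n d (WithLp.toLp 2 y)) = 0 :=
      hφ (Submodule.subset_span ⟨_, rfl⟩)
    rw [LinearMap.pi_apply_eq_sum_univ] at hy
    rw [map_zero, ← hy, map_sum]
    refine Finset.sum_congr rfl fun k _ => ?_
    rw [MvPolynomial.eval_monomial, Finsupp.prod_fintype _ _ (by simp)]
    rw [show (Pi.single k 1 : _ → ℝ) = fun j => if k = j then 1 else 0 from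
      funext fun j => by simp [Pi.single_apply, eq_comm]]
    simp [veronese, mul_comm]
  refine LinearMap.pi_ext' fun k => LinearMap.ext_ring ?_
  have := congrArg (MvPolynomial.coeff (Finsupp.equivFunOnFinite.symm k.1)) hp
  simp only [p, MvPolynomial.coeff_sum, MvPolynomial.coeff_monomial, MvPolynomial.coeff_zero,
    EmbeddingLike.apply_eq_iff_eq, Subtype.val_inj] at this
  simpa using this

theorem exists_isUnitVector (hn : 1 ≤ n) : ∃ e : EuclideanSpace ℝ (Fin n), ‖e‖ = 1 :=
  ⟨EuclideanSpace.single ⟨0, hn⟩ 1, by simp⟩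

theorem sum_mul_mem_decompositionCosts {ι : Type*} [Fintype ι] (hn : 1 ≤ n)
    {f : MvPolynomial (Fin n) ℝ} (lam : ι → ℝ) (v : ι → EuclideanSpace ℝ (Fin n))
    (hf : ∀ x, evalForm f x = ∑ k, lam k * (∑ i, v k i * x i) ^ d) :
    ∑ k, |lam k| * ‖v k‖ ^ d ∈ decompositionCosts d f := by
  classical
  obtain ⟨e, he⟩ := exists_isUnitVector hn
  let q := (Fintype.equivFin ι).symm
  -- The relation `‖v k‖ • u k = v k` survives at `v k = 0`, so any unit vector will do there.
  let u : ι → EuclideanSpace ℝ (Fin n) := fun k => if v k = 0 then e else ‖v k‖⁻¹ • v k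
  have hu : ∀ k, ‖u k‖ = 1 := by
    intro k
    by_cases h : v k = 0
    · simp [u, h, he]
    · simp [u, h, norm_smul]
  refine ⟨Fintype.card ι, fun k => lam (q k) * ‖v (q k)‖ ^ d, fun k => u (q k),
    fun k => hu _, fun x => ?_, ?_⟩
  · rw [hf, ← q.sum_comp]
    refine Finset.sum_congr rfl fun k _ => ?_
    rw [mul_assoc, ← mul_pow]
    congr 2
    by_cases h : v (q k) = 0
    · simp [h]
    · simp only [u, h, if_false, Finset.mul_sum, PiLp.smul_apply, smul_eq_mul]
      refine Finset.sum_congr rfl fun i _ => ?_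
      have : ‖v (q k)‖ ≠ 0 := norm_ne_zero_iff.2 h
      field_simp
  · rw [← q.sum_comp]
    simp [abs_mul]

theorem evalForm_eq_sum_piAntidiag {f : MvPolynomial (Fin n) ℝ} (hf : f.IsHomogeneous d)
    (x : EuclideanSpace ℝ (Fin n)) :
    evalForm f x = ∑ k : (Finset.piAntidiag (Finset.univ : Finset (Fin n)) d),
      f.coeff (Finsupp.equivFunOnFinite.symm k.1) * ∏ i, x i ^ k.1 i := by
  rw [evalForm, MvPolynomial.eval_eq', Finset.sum_coe_sort _
    (fun k : Fin n → ℕ => f.coeff (Finsupp.equivFunOnFinite.symm k) * ∏ i, x i ^ k i)]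
  refine Finset.sum_of_injOn (fun m => (m : Fin n → ℕ)) DFunLike.coe_injective.injOn ?_ ?_ ?_
  · intro m hm
    have := hf (MvPolynomial.mem_support_iff.1 hm)
    rw [Finsupp.weight_apply, Finsupp.sum_fintype _ _ (by simp)] at this
    simpa using this
  · intro k _ hk
    have : f.coeff (Finsupp.equivFunOnFinite.symm k) = 0 := by
      by_contra h
      exact hk ⟨_, Finset.mem_coe.2 (MvPolynomial.mem_support_iff.2 h), rfl⟩
    simp [this]
  · intro m _
    simp

theorem decompositionCosts_nonempty (hn : 1 ≤ n) {f : MvPolynomial (Fin n) ℝ}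
    (hf : f.IsHomogeneous d) : (decompositionCosts d f).Nonempty := by
  -- Dividing by the multinomial coefficients makes `powerFunctional n d x t` equal to f(x).
  let t : (Finset.piAntidiag (Finset.univ : Finset (Fin n)) d) → ℝ := fun k =>
    f.coeff (Finsupp.equivFunOnFinite.symm k.1) / Nat.multinomial Finset.univ k.1
  have ht : t ∈ Submodule.span ℝ (Set.range (veronese n d)) := by
    rw [span_range_veronese]
    trivial
  obtain ⟨c, hc⟩ := (Finsupp.mem_span_range_iff_exists_finsupp).1 ht
  refine ⟨_, sum_mul_mem_decompositionCosts hn (fun y : c.support => c y) (fun y => y.1) ?_⟩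
  intro x
  have h1 : evalForm f x = powerFunctional n d x t := by
    rw [evalForm_eq_sum_piAntidiag hf]
    refine Finset.sum_congr rfl fun k _ => ?_
    have : (Nat.multinomial Finset.univ k.1 : ℝ) ≠ 0 := by
      exact_mod_cast (Nat.multinomial_pos _ _).ne'
    simp only [t]
    field_simp
  rw [h1, ← hc, Finsupp.sum, map_sum, ← Finset.sum_coe_sort]
  simp only [map_smul, powerFunctional_veronese, smul_eq_mul]

theorem sum_mul_eq_inner (v x : EuclideanSpace ℝ (Fin n)) :
    ∑ i, v i * x i = inner ℝ v x := by
  simp [PiLp.inner_apply, mul_comm]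

/-! ### Rotation invariance and averaging -/

/-- The integral of a power of a linear form against a radial weight depends only on the norm of
the linear form. -/
theorem integral_radial_mul_linear_pow (h : ℝ → ℝ) {e : EuclideanSpace ℝ (Fin n)} (he : ‖e‖ = 1)
    (v : EuclideanSpace ℝ (Fin n)) :
    ∫ x : EuclideanSpace ℝ (Fin n), h ‖x‖ * (∑ i, v i * x i) ^ d =
      ‖v‖ ^ d * ∫ x : EuclideanSpace ℝ (Fin n), h ‖x‖ * (∑ i, e i * x i) ^ d := by
  simp only [sum_mul_eq_inner]
  let u := ‖v‖ • e
  have hu : ‖u‖ = ‖v‖ := by simp [u, norm_smul, he]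
  -- Reflection in the hyperplane bisecting u and v, two vectors of equal norm, exchanges them.
  let R := (ℝ ∙ (u - v))ᗮ.reflection
  have hR : R u = v := Submodule.reflection_sub hu
  rw [← (R.measurePreserving).integral_comp R.toHomeomorph.measurableEmbedding,
    ← integral_const_mul]
  refine integral_congr_ae (.of_forall fun x => ?_)
  simp only [LinearIsometryEquiv.norm_map]
  rw [← hR, LinearIsometryEquiv.inner_map_map]
  simp only [u, inner_smul_left, LinearIsometryEquiv.norm_map, norm_smul, he, mul_pow]
  simp
  ring

theorem integrable_radial_mul_linear_pow {h : ℝ → ℝ} (hm : Measurable h)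
    (hi : Integrable fun x : EuclideanSpace ℝ (Fin n) => h ‖x‖ * ‖x‖ ^ d)
    (v : EuclideanSpace ℝ (Fin n)) :
    Integrable fun x : EuclideanSpace ℝ (Fin n) => h ‖x‖ * (∑ i, v i * x i) ^ d := by
  simp only [sum_mul_eq_inner]
  refine (hi.const_mul (‖v‖ ^ d)).mono (by fun_prop) (.of_forall fun x => ?_)
  have h1 : |inner ℝ v x| ^ d ≤ (‖v‖ * ‖x‖) ^ d :=
    pow_le_pow_left₀ (abs_nonneg _) (abs_real_inner_le_norm v x) d
  simp only [norm_mul, norm_pow, Real.norm_eq_abs, abs_norm] at h1 ⊢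
  calc |h ‖x‖| * |inner ℝ v x| ^ d ≤ |h ‖x‖| * (‖v‖ * ‖x‖) ^ d := by gcongr
    _ = _ := by ring

theorem setIntegral_closedBall (G : EuclideanSpace ℝ (Fin n) → ℝ) (R : ℝ) :
    ∫ y in Metric.closedBall 0 R, G y = ∫ y, (Set.Iic R).indicator 1 ‖y‖ * G y := by
  rw [← integral_indicator Metric.isClosed_closedBall.measurableSet]
  refine integral_congr_ae (.of_forall fun y => ?_)
  by_cases h : ‖y‖ ≤ R <;> simp [h]

/-- A power of the norm is a combination with nonnegative coefficients of powers of linear forms. -/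
theorem exists_norm_pow_eq_sum {e : EuclideanSpace ℝ (Fin n)} (he : ‖e‖ = 1) :
    ∃ (ι : Type) (_ : Fintype ι) (w : ι → ℝ) (v : ι → EuclideanSpace ℝ (Fin n)),
      (∀ k, 0 ≤ w k) ∧
      (∀ x : EuclideanSpace ℝ (Fin n),
        (∫ y in Metric.closedBall (0 : EuclideanSpace ℝ (Fin n)) 1, (∑ i, e i * y i) ^ d) *
          ‖x‖ ^ d = ∑ k, w k * (∑ i, v k i * x i) ^ d) ∧
      ∑ k, w k * ‖v k‖ ^ d =
        ∫ y in Metric.closedBall (0 : EuclideanSpace ℝ (Fin n)) 1, ‖y‖ ^ d := by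
  let B := Metric.closedBall (0 : EuclideanSpace ℝ (Fin n)) 1
  -- Adjoining ‖y‖ ^ d to the monomials lets one convex combination reproduce both the form and its
  -- total mass.
  let F : EuclideanSpace ℝ (Fin n) → _ := fun y => (veronese n d y, ‖y‖ ^ d)
  have hF : Continuous F := continuous_veronese.prodMk (by fun_prop)
  have hB : IsCompact B := isCompact_closedBall _ _
  have hBpos : 0 < volume B := Metric.measure_closedBall_pos _ _ one_pos
  have hFi : IntegrableOn F B := hF.continuousOn.integrableOn_compact hB
  have hmem : ⨍ y in B, F y ∈ convexHull ℝ (F '' B) := by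
    refine (convex_convexHull ℝ _).set_average_mem
      (hB.image hF).convexHull_of_finiteDimensional.isClosed hBpos.ne' hB.measure_ne_top ?_ hFi
    filter_upwards [ae_restrict_mem Metric.isClosed_closedBall.measurableSet] with y hy
    exact subset_convexHull ℝ _ ⟨y, hy, rfl⟩
  obtain ⟨ι, _, w, z, hw, -, hz, hsum⟩ := mem_convexHull_iff_exists_fintype.1 hmem
  choose v hv hvz using hz
  have hV : 0 < volume.real B := ENNReal.toReal_pos hBpos.ne' hB.measure_ne_top
  have key : ∀ L : _ →L[ℝ] ℝ, ∑ k, volume.real B * w k * L (F (v k)) = ∫ y in B, L (F y) := by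
    intro L
    rw [L.integral_comp_comm hFi]
    have := congrArg L hsum
    rw [setAverage_eq, map_sum, map_smul] at this
    simp only [map_smul, smul_eq_mul, ← hvz] at this
    simp only [mul_assoc]
    rw [← Finset.mul_sum, this]
    field_simp
  refine ⟨ι, inferInstance, fun k => volume.real B * w k, v,
    fun k => mul_nonneg hV.le (hw k), fun x => ?_, ?_⟩
  · have h1 := key (((powerFunctional n d x).comp
      (LinearMap.fst ℝ _ ℝ)).toContinuousLinearMap)
    simp only [LinearMap.coe_toContinuousLinearMap', LinearMap.comp_apply, LinearMap.fst_apply, F,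
      powerFunctional_veronese] at h1
    rw [h1]
    -- Here x plays the linear form and y is integrated: the average over y depends on x only
    -- through ‖x‖ ^ d.
    have h2 := integral_radial_mul_linear_pow (d := d)
      (fun r => (Set.Iic (1 : ℝ)).indicator 1 r) he x
    rw [setIntegral_closedBall, setIntegral_closedBall, mul_comm, ← h2]
    simp only [mul_comm (x _)]
  · exact key (LinearMap.snd ℝ _ ℝ).toContinuousLinearMap

/-! ### Gaussian moments -/

theorem Real.Gamma_add_natCast_eq_prod {s : ℝ} (hs : 0 < s) (m : ℕ) :
    Real.Gamma (s + m) = (∏ i ∈ Finset.range m, (s + i)) * Real.Gamma s := by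
  induction m with
  | zero => simp
  | succ m ih =>
    rw [Finset.prod_range_succ, Nat.cast_succ, ← add_assoc,
      Real.Gamma_add_one (by positivity), ih]
    ring

theorem integral_exp_neg_sq_mul_pow (m : ℕ) :
    ∫ t : ℝ, Real.exp (-t ^ 2) * t ^ (2 * m) = Real.Gamma (1 / 2 + m) := by
  have h := integral_comp_abs (f := fun t : ℝ => Real.exp (-t ^ 2) * t ^ (2 * m))
  simp only [sq_abs, Even.pow_abs (even_two_mul m)] at h
  rw [h]
  have := integral_rpow_mul_exp_neg_rpow (p := 2) (q := (2 * m : ℕ)) two_pos (by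
    have : (0 : ℝ) ≤ (2 * m : ℕ) := by positivity
    linarith)
  simp only [Real.rpow_natCast, Real.rpow_two] at this
  simp only [mul_comm (Real.exp _)]
  rw [this]
  push_cast
  rw [show (2 * (m : ℝ) + 1) / 2 = 1 / 2 + m by ring]
  ring

theorem integral_exp_neg_norm_sq_mul_norm_pow (hn : 1 ≤ n) (m : ℕ) :
    ∫ x : EuclideanSpace ℝ (Fin n), Real.exp (-‖x‖ ^ 2) * ‖x‖ ^ (2 * m) =
      Real.sqrt Real.pi ^ n * Real.Gamma (n / 2 + m) / Real.Gamma (n / 2) := by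
  have : Nonempty (Fin n) := ⟨⟨0, hn⟩⟩
  have hn' : (0 : ℝ) < n := by exact_mod_cast hn
  rw [integral_fun_norm_addHaar volume fun r => Real.exp (-r ^ 2) * r ^ (2 * m)]
  have := integral_rpow_mul_exp_neg_rpow (p := 2) (q := (2 * m + (n - 1) : ℕ)) two_pos (by
    have : (0 : ℝ) ≤ (2 * m + (n - 1) : ℕ) := by positivity
    linarith)
  simp only [Real.rpow_natCast, Real.rpow_two] at this
  have h2 : ∀ y : ℝ, y ^ (n - 1) • (Real.exp (-y ^ 2) * y ^ (2 * m)) =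
      y ^ (2 * m + (n - 1)) * Real.exp (-y ^ 2) := by
    intro y
    rw [smul_eq_mul, pow_add]
    ring
  simp only [finrank_euclideanSpace, Fintype.card_fin, h2, this]
  rw [Measure.real, EuclideanSpace.volume_ball, ENNReal.toReal_mul, ENNReal.toReal_pow,
    ENNReal.toReal_ofReal zero_le_one, ENNReal.toReal_ofReal (by positivity),
    Real.Gamma_add_one (by simp; omega)]
  push_cast [Nat.cast_sub hn]
  have : Real.Gamma (n / 2) ≠ 0 := (Real.Gamma_pos_of_pos (by positivity)).ne'
  rw [show (2 * (m : ℝ) + (n - 1) + 1) / 2 = n / 2 + m by ring]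
  simp only [Fintype.card_fin, nsmul_eq_mul, smul_eq_mul]
  field_simp
  simp

theorem integral_exp_neg_norm_sq_mul_coord_pow (i₀ : Fin n) (m : ℕ) :
    ∫ x : EuclideanSpace ℝ (Fin n), Real.exp (-‖x‖ ^ 2) * x i₀ ^ (2 * m) =
      Real.sqrt Real.pi ^ n * Real.Gamma (1 / 2 + m) / Real.Gamma (1 / 2) := by
  classical
  rw [← (PiLp.volume_preserving_toLp (Fin n)).integral_comp
    (MeasurableEquiv.toLp 2 (Fin n → ℝ)).measurableEmbedding]
  let g : Fin n → ℝ → ℝ := fun i t =>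
    Real.exp (-t ^ 2) * if i = i₀ then t ^ (2 * m) else 1
  have h1 : ∀ x : Fin n → ℝ, Real.exp (-‖WithLp.toLp 2 x‖ ^ 2) * x i₀ ^ (2 * m) =
      ∏ i, g i (x i) := by
    intro x
    simp only [g, Finset.prod_mul_distrib, Finset.prod_ite_eq', Finset.mem_univ, if_true,
      ← Real.exp_sum, EuclideanSpace.norm_sq_eq, Finset.sum_neg_distrib, Real.norm_eq_abs, sq_abs]
  simp only [h1]
  rw [integral_fintype_prod_volume_eq_prod]
  have h2 : ∀ i, ∫ t, g i t = Real.sqrt Real.pi *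
      if i = i₀ then Real.Gamma (1 / 2 + m) / Real.Gamma (1 / 2) else 1 := by
    intro i
    by_cases h : i = i₀
    · simp only [g, h, if_true, integral_exp_neg_sq_mul_pow]
      rw [Real.Gamma_one_half_eq]
      field_simp
    · have := integral_gaussian 1
      simp only [g, h, if_false, mul_one]
      simpa using this
  simp only [h2, Finset.prod_mul_distrib, Finset.prod_ite_eq', Finset.mem_univ, if_true,
    Finset.prod_const, Finset.card_univ, Fintype.card_fin]
  ring

/-! ### The sphere moment and the bound on centred balls -/

/-- The mean over the unit sphere of `ℝ^n` of the `2m`-th power of a coordinate. -/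
noncomputable def sphereMoment (n m : ℕ) : ℝ :=
  ∏ i ∈ Finset.range m, (2 * (i : ℝ) + 1) / (2 * (i : ℝ) + n)

theorem sphereMoment_pos (hn : 1 ≤ n) : 0 < sphereMoment n m := by
  have hn' : (0 : ℝ) < n := by exact_mod_cast hn
  exact Finset.prod_pos fun i _ => by positivity

theorem setIntegral_closedBall_norm_pow_pos (hn : 1 ≤ n) {R : ℝ} (hR : 0 < R) :
    0 < ∫ y in Metric.closedBall (0 : EuclideanSpace ℝ (Fin n)) R, ‖y‖ ^ d := by
  obtain ⟨e, he⟩ := exists_isUnitVector hn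
  have hi : IntegrableOn (fun y : EuclideanSpace ℝ (Fin n) => ‖y‖ ^ d) (Metric.closedBall 0 R) :=
    (continuous_norm.pow d).continuousOn.integrableOn_compact (isCompact_closedBall _ _)
  rw [setIntegral_pos_iff_support_of_nonneg_ae (.of_forall fun y => by positivity) hi]
  have ho : IsOpen (Metric.ball (0 : EuclideanSpace ℝ (Fin n)) R \ {0}) :=
    Metric.isOpen_ball.sdiff isClosed_singleton
  refine (ho.measure_pos volume ⟨(R / 2) • e, ?_, ?_⟩).trans_le (measure_mono ?_)
  · rw [mem_ball_zero_iff, norm_smul, he, Real.norm_eq_abs, abs_of_pos (by positivity)]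
    linarith
  · have : e ≠ 0 := norm_ne_zero_iff.1 (he ▸ one_ne_zero)
    simp [this, hR.ne']
  · rintro y ⟨hy, hy0⟩
    exact ⟨pow_ne_zero _ (norm_ne_zero_iff.2 hy0), Metric.ball_subset_closedBall hy⟩

theorem integral_radial_decomposition {ι : Type*} [Fintype ι] {e : EuclideanSpace ℝ (Fin n)}
    (he : ‖e‖ = 1) {F : EuclideanSpace ℝ (Fin n) → ℝ} {w : ι → ℝ}
    {v : ι → EuclideanSpace ℝ (Fin n)} (hF : ∀ x, F x = ∑ k, w k * (∑ i, v k i * x i) ^ d)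
    {h : ℝ → ℝ} (hm : Measurable h)
    (hi : Integrable fun x : EuclideanSpace ℝ (Fin n) => h ‖x‖ * ‖x‖ ^ d) :
    ∫ x, h ‖x‖ * F x = (∑ k, w k * ‖v k‖ ^ d) *
      ∫ x : EuclideanSpace ℝ (Fin n), h ‖x‖ * (∑ i, e i * x i) ^ d := by
  have h1 : ∀ x, h ‖x‖ * F x = ∑ k, w k * (h ‖x‖ * (∑ i, v k i * x i) ^ d) := by
    intro x
    rw [hF, Finset.mul_sum]
    exact Finset.sum_congr rfl fun k _ => by ring
  simp only [h1]
  rw [integral_finsetSum _ fun k _ =>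
    (integrable_radial_mul_linear_pow hm hi (v k)).const_mul (w k), Finset.sum_mul]
  refine Finset.sum_congr rfl fun k _ => ?_
  rw [integral_const_mul, integral_radial_mul_linear_pow h he, mul_assoc]

/-- The normalized power of the norm is an average of powers of linear forms of total mass one. -/
theorem exists_sphereMoment_mul_norm_pow_eq_sum (hn : 1 ≤ n) (m : ℕ) :
    ∃ (ι : Type) (_ : Fintype ι) (w : ι → ℝ) (v : ι → EuclideanSpace ℝ (Fin n)),
      (∀ k, 0 ≤ w k) ∧
      (∀ x : EuclideanSpace ℝ (Fin n),
        sphereMoment n m * ‖x‖ ^ (2 * m) = ∑ k, w k * (∑ i, v k i * x i) ^ (2 * m)) ∧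
      ∑ k, w k * ‖v k‖ ^ (2 * m) = 1 := by
  let e : EuclideanSpace ℝ (Fin n) := EuclideanSpace.single ⟨0, hn⟩ 1
  have he : ‖e‖ = 1 := by simp [e]
  have hn' : (0 : ℝ) < n := by exact_mod_cast hn
  obtain ⟨ι, _, w, v, hw, hsum, hmass⟩ := exists_norm_pow_eq_sum (d := 2 * m) he
  have hM : 0 < ∫ y in Metric.closedBall (0 : EuclideanSpace ℝ (Fin n)) 1, ‖y‖ ^ (2 * m) :=
    setIntegral_closedBall_norm_pow_pos hn one_pos
  have hN := integral_exp_neg_norm_sq_mul_norm_pow hn m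
  have hG1 : 0 < Real.Gamma (n / 2 : ℝ) := Real.Gamma_pos_of_pos (by positivity)
  have hG2 : 0 < Real.Gamma (1 / 2 : ℝ) := Real.Gamma_pos_of_pos (by positivity)
  rw [Real.Gamma_add_natCast_eq_prod (by positivity), mul_div_assoc, mul_div_cancel_right₀ _ hG1.ne']
    at hN
  have hK := integral_exp_neg_norm_sq_mul_coord_pow (⟨0, hn⟩ : Fin n) m
  rw [Real.Gamma_add_natCast_eq_prod (by positivity), mul_div_assoc, mul_div_cancel_right₀ _ hG2.ne']
    at hK
  have hNpos : 0 < Real.sqrt Real.pi ^ n * ∏ i ∈ Finset.range m, ((n : ℝ) / 2 + i) :=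
    mul_pos (by positivity) (Finset.prod_pos fun i _ => by positivity)
  -- A nonintegrable function has integral 0 by convention, so a nonzero value proves integrability.
  have hi := Integrable.of_integral_ne_zero (hN ▸ hNpos.ne')
  -- Integrating the identity against a Gaussian fixes the ratio of the two ball constants: it is
  -- that of the coordinate moment to the norm moment.
  have h1 := integral_radial_decomposition he hsum (h := fun r => Real.exp (-r ^ 2))
    (by fun_prop) hi
  have hc : Real.sqrt Real.pi ^ n * ∏ i ∈ Finset.range m, (1 / 2 + (i : ℝ)) =
      sphereMoment n m * (Real.sqrt Real.pi ^ n * ∏ i ∈ Finset.range m, ((n : ℝ) / 2 + i)) := by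
    rw [mul_left_comm, sphereMoment, ← Finset.prod_mul_distrib]
    congr 1
    refine Finset.prod_congr rfl fun i _ => ?_
    have : (2 * (i : ℝ) + n) ≠ 0 := by positivity
    field_simp
    ring
  have he' : ∀ x : EuclideanSpace ℝ (Fin n), ∑ i, e i * x i = x ⟨0, hn⟩ := by
    intro x
    simp [e]
  simp only [he', mul_left_comm _ (∫ y in _, (_ : ℝ))] at h1
  rw [hK, hmass, integral_const_mul, hN, hc] at h1
  have h2 := mul_right_cancel₀ hNpos.ne' (h1.trans (mul_assoc _ _ _).symm)
  simp only [he', h2] at hsum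
  set M := ∫ y in Metric.closedBall (0 : EuclideanSpace ℝ (Fin n)) 1, ‖y‖ ^ (2 * m)
  refine ⟨ι, inferInstance, fun k => w k / M, v, fun k => div_nonneg (hw k) hM.le,
    fun x => ?_, ?_⟩
  · simp only [div_mul_eq_mul_div, ← Finset.sum_div]
    rw [← hsum, mul_assoc, mul_div_cancel_left₀ _ hM.ne']
  · simp only [div_mul_eq_mul_div, ← Finset.sum_div]
    rw [hmass, div_self hM.ne']

theorem integral_radial_mul_unit_linear_pow (hn : 1 ≤ n) {e : EuclideanSpace ℝ (Fin n)}
    (he : ‖e‖ = 1) {h : ℝ → ℝ} (hm : Measurable h)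
    (hi : Integrable fun x : EuclideanSpace ℝ (Fin n) => h ‖x‖ * ‖x‖ ^ (2 * m)) :
    ∫ x : EuclideanSpace ℝ (Fin n), h ‖x‖ * (∑ i, e i * x i) ^ (2 * m) =
      sphereMoment n m * ∫ x : EuclideanSpace ℝ (Fin n), h ‖x‖ * ‖x‖ ^ (2 * m) := by
  obtain ⟨ι, _, w, v, -, hsum, hmass⟩ := exists_sphereMoment_mul_norm_pow_eq_sum hn m
  have := integral_radial_decomposition he hsum hm hi
  rw [hmass, one_mul] at this
  rw [← this, ← integral_const_mul]
  exact integral_congr_ae (.of_forall fun x => by ring)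

theorem setIntegral_evalForm_le (hn : 1 ≤ n) {f : MvPolynomial (Fin n) ℝ} {s : ℝ}
    (hs : s ∈ decompositionCosts (2 * m) f) (R : ℝ) :
    ∫ x in Metric.closedBall 0 R, evalForm f x ≤
      s * (sphereMoment n m *
        ∫ x in Metric.closedBall (0 : EuclideanSpace ℝ (Fin n)) R, ‖x‖ ^ (2 * m)) := by
  obtain ⟨r, lam, y, hy, hf, rfl⟩ := hs
  obtain ⟨e, he⟩ := exists_isUnitVector hn
  have hm : Measurable ((Set.Iic R).indicator (1 : ℝ → ℝ)) :=
    measurable_one.indicator measurableSet_Iic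
  have hi : Integrable fun x : EuclideanSpace ℝ (Fin n) =>
      (Set.Iic R).indicator 1 ‖x‖ * ‖x‖ ^ (2 * m) := by
    have h1 : IntegrableOn (fun x : EuclideanSpace ℝ (Fin n) => ‖x‖ ^ (2 * m))
        (Metric.closedBall 0 R) :=
      (continuous_norm.pow _).continuousOn.integrableOn_compact (isCompact_closedBall _ _)
    rw [← integrable_indicator_iff Metric.isClosed_closedBall.measurableSet] at h1
    refine h1.congr (.of_forall fun x => ?_)
    by_cases h : ‖x‖ ≤ R <;> simp [h]
  rw [setIntegral_closedBall, setIntegral_closedBall,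
    integral_radial_decomposition he hf hm hi, integral_radial_mul_unit_linear_pow hn he hm hi]
  simp only [hy, one_pow, mul_one]
  refine mul_le_mul_of_nonneg_right (Finset.sum_le_sum fun k _ => le_abs_self _) ?_
  refine mul_nonneg (sphereMoment_pos hn).le (integral_nonneg fun x => ?_)
  exact mul_nonneg (Set.indicator_nonneg (fun _ _ => zero_le_one) _) (by positivity)

/-! ### The nuclear norm of the Euclidean form -/

theorem evalForm_euclideanForm (x : EuclideanSpace ℝ (Fin n)) :
    evalForm (euclideanForm (2 * m) n) x = ‖x‖ ^ (2 * m) := by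
  simp [evalForm, euclideanForm, pow_mul, EuclideanSpace.norm_sq_eq]

theorem isHomogeneous_euclideanForm : (euclideanForm (2 * m) n).IsHomogeneous (2 * m) := by
  rw [euclideanForm, Nat.mul_div_cancel_left _ two_pos]
  exact (MvPolynomial.IsHomogeneous.sum _ _ _ fun i _ => MvPolynomial.isHomogeneous_X_pow i 2).pow m

theorem evalForm_smul (c : ℝ) (f : MvPolynomial (Fin n) ℝ) (x : EuclideanSpace ℝ (Fin n)) :
    evalForm (c • f) x = c * evalForm f x := by
  simp [evalForm, MvPolynomial.smul_eval]

/-- Used with a = 1 for membership in the unit ball, and with a the inverse moment for the upper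
bound on the nuclear norm. -/
theorem mem_decompositionCosts_euclideanForm (hn : 1 ≤ n) {a : ℝ} (ha : 0 ≤ a) :
    a ∈ decompositionCosts (2 * m) ((a * sphereMoment n m) • euclideanForm (2 * m) n) := by
  obtain ⟨ι, _, w, v, hw, hsum, hmass⟩ := exists_sphereMoment_mul_norm_pow_eq_sum hn m
  convert sum_mul_mem_decompositionCosts hn (fun k => a * w k) v (fun x => ?_)
  · simp only [abs_mul, abs_of_nonneg ha, abs_of_nonneg (hw _), mul_assoc, ← Finset.mul_sum, hmass,
      mul_one]
  · simp only [evalForm_smul, evalForm_euclideanForm, mul_assoc, ← Finset.mul_sum, hsum]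

theorem bddBelow_decompositionCosts (f : MvPolynomial (Fin n) ℝ) :
    BddBelow (decompositionCosts d f) := by
  refine ⟨0, ?_⟩
  rintro s ⟨r, lam, y, -, -, rfl⟩
  exact Finset.sum_nonneg fun _ _ => abs_nonneg _

theorem nuclearNorm_euclideanForm (hn : 1 ≤ n) :
    nuclearNorm (2 * m) (euclideanForm (2 * m) n) = (sphereMoment n m)⁻¹ := by
  have hc := sphereMoment_pos (m := m) hn
  have hmem : (sphereMoment n m)⁻¹ ∈ decompositionCosts (2 * m) (euclideanForm (2 * m) n) := by
    simpa [inv_mul_cancel₀ hc.ne'] using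
      mem_decompositionCosts_euclideanForm (m := m) hn (inv_pos.2 hc).le
  refine le_antisymm (csInf_le (bddBelow_decompositionCosts _) hmem)
    (le_csInf ⟨_, hmem⟩ fun s hs => ?_)
  have h1 := setIntegral_evalForm_le hn hs 1
  simp only [evalForm_euclideanForm, ← mul_assoc] at h1
  rw [inv_le_iff_one_le_mul₀ hc]
  exact le_of_mul_le_mul_right (by simpa using h1)
    (setIntegral_closedBall_norm_pow_pos (d := 2 * m) hn one_pos)

theorem normalizedEuclideanForm_eq (hn : 1 ≤ n) :
    normalizedEuclideanForm (2 * m) n = sphereMoment n m • euclideanForm (2 * m) n := by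
  rw [normalizedEuclideanForm, nuclearNorm_euclideanForm hn, inv_inv]

theorem evalForm_normalizedEuclideanForm (hn : 1 ≤ n) (x : EuclideanSpace ℝ (Fin n)) :
    evalForm (normalizedEuclideanForm (2 * m) n) x = sphereMoment n m * ‖x‖ ^ (2 * m) := by
  rw [normalizedEuclideanForm_eq hn, evalForm_smul, evalForm_euclideanForm]

theorem isHomogeneous_normalizedEuclideanForm (hn : 1 ≤ n) :
    (normalizedEuclideanForm (2 * m) n).IsHomogeneous (2 * m) := by
  rw [normalizedEuclideanForm_eq hn, MvPolynomial.smul_eq_C_mul]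
  exact isHomogeneous_euclideanForm.C_mul _

theorem nuclearNorm_normalizedEuclideanForm_le (hn : 1 ≤ n) :
    nuclearNorm (2 * m) (normalizedEuclideanForm (2 * m) n) ≤ 1 := by
  refine csInf_le (bddBelow_decompositionCosts _) ?_
  have := mem_decompositionCosts_euclideanForm (m := m) hn zero_le_one
  rwa [one_mul, ← normalizedEuclideanForm_eq hn] at this

/-- On centred balls, no form in the unit ball of the nuclear norm has a larger integral than the
normalized Euclidean form. -/
theorem setIntegral_evalForm_le_normalizedEuclideanForm (hn : 1 ≤ n)
    {f : MvPolynomial (Fin n) ℝ} (hf : f.IsHomogeneous (2 * m))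
    (hf1 : nuclearNorm (2 * m) f ≤ 1) (R : ℝ) :
    ∫ x in Metric.closedBall 0 R, evalForm f x ≤
      ∫ x in Metric.closedBall 0 R, evalForm (normalizedEuclideanForm (2 * m) n) x := by
  simp only [evalForm_normalizedEuclideanForm hn, integral_const_mul]
  refine le_of_forall_pos_le_add fun ε hε => ?_
  set N := sphereMoment n m *
    ∫ x in Metric.closedBall (0 : EuclideanSpace ℝ (Fin n)) R, ‖x‖ ^ (2 * m) with hN
  have hN0 : 0 ≤ N := mul_nonneg (sphereMoment_pos hn).le (integral_nonneg fun x => by positivity)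
  -- A cost close to the infimum avoids proving that it is attained; the denominator is N + 1
  -- because N can vanish.
  obtain ⟨s, hs, hlt⟩ := exists_lt_of_csInf_lt (decompositionCosts_nonempty hn hf)
    (show nuclearNorm (2 * m) f < 1 + ε / (N + 1) by
      have : 0 < ε / (N + 1) := by positivity
      linarith)
  calc _ ≤ s * N := setIntegral_evalForm_le hn hs R
    _ ≤ (1 + ε / (N + 1)) * N := by gcongr
    _ = N + ε * (N / (N + 1)) := by ring
    _ ≤ N + ε * 1 := by
      gcongr
      rw [div_le_one (by positivity)]
      linarith
    _ = N + ε := by ring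

/-! ### Sublevel sets of homogeneous functions -/

theorem volume_sublevel_of_homogeneous {F : EuclideanSpace ℝ (Fin n) → ℝ} (hd : d ≠ 0)
    (hF : ∀ t : ℝ, ∀ x, F (t • x) = t ^ d * F x) {s : ℝ} (hs : 0 < s) :
    volume {x | F x ≤ s} = ENNReal.ofReal (s ^ ((n : ℝ) / d)) * volume {x | F x ≤ 1} := by
  have hr : 0 < s ^ (1 / (d : ℝ)) := Real.rpow_pos_of_pos hs _
  have hrd : (s ^ (1 / (d : ℝ))) ^ d = s := by
    rw [one_div, Real.rpow_inv_natCast_pow hs.le hd]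
  have h1 : {x | F x ≤ s} = s ^ (1 / (d : ℝ)) • {x | F x ≤ 1} := by
    ext x
    rw [Set.mem_smul_set_iff_inv_smul_mem₀ hr.ne', Set.mem_ofPred_eq, Set.mem_ofPred_eq, hF, inv_pow,
      hrd, inv_mul_le_iff₀ hs, mul_one]
  rw [h1, Measure.addHaar_smul_of_nonneg _ hr.le, finrank_euclideanSpace_fin,
    ← Real.rpow_mul_natCast hs.le, one_div_mul_eq_div]

theorem max_one_sub_eq_indicator {α : Type*} (F : α → ℝ) :
    (fun x => max (1 - F x) 0) = {x | F x ≤ 1}.indicator fun x => 1 - F x := by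
  ext x
  by_cases h : F x ≤ 1
  · simp [h]
  · simp [h, (not_le.1 h).le]

theorem integrable_max_one_sub {F : EuclideanSpace ℝ (Fin n) → ℝ} (hFc : Continuous F)
    (hF0 : ∀ x, 0 ≤ F x) (hfin : volume {x | F x ≤ 1} ≠ ⊤) :
    Integrable fun x => max (1 - F x) 0 := by
  have hms : MeasurableSet {x | F x ≤ 1} := measurableSet_le hFc.measurable measurable_const
  have h1 : Integrable ({x | F x ≤ 1}.indicator fun _ => (1 : ℝ)) :=
    (integrable_indicator_iff hms).2 (integrableOn_const hfin)
  refine h1.mono (by fun_prop) (.of_forall fun x => ?_)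
  rw [Real.norm_of_nonneg (le_max_right _ _)]
  by_cases h : F x ≤ 1
  · simp [h, hF0]
  · simp [h, (not_le.1 h).le]

/-- Layer cake: the superlevel set at height t is {F ≤ 1 - t}, whose volume scales as (1 - t) ^ (n /
d). -/
theorem integral_max_one_sub_of_homogeneous {F : EuclideanSpace ℝ (Fin n) → ℝ} (hd : d ≠ 0)
    (hF : ∀ t : ℝ, ∀ x, F (t • x) = t ^ d * F x) (hFc : Continuous F)
    (hF0 : ∀ x, 0 ≤ F x) (hfin : volume {x | F x ≤ 1} ≠ ⊤) :
    ∫ x, max (1 - F x) 0 = 1 / ((n : ℝ) / d + 1) * volume.real {x | F x ≤ 1} := by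
  rw [(integrable_max_one_sub hFc hF0 hfin).integral_eq_integral_Ioc_meas_le (M := 1)
    (.of_forall fun x => le_max_right _ _)
    (.of_forall fun x => max_le (by linarith [hF0 x]) zero_le_one)]
  have h1 : ∫ t in Set.Ioc (0 : ℝ) 1, volume.real {x | t ≤ max (1 - F x) 0} =
      ∫ t in Set.Ioc (0 : ℝ) 1, (1 - t) ^ ((n : ℝ) / d) * volume.real {x | F x ≤ 1} := by
    -- The endpoint t = 1 is dropped because the scaling law needs 1 - t > 0.
    rw [integral_Ioc_eq_integral_Ioo, integral_Ioc_eq_integral_Ioo]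
    refine setIntegral_congr_fun measurableSet_Ioo fun t ht => ?_
    have h2 : {x | t ≤ max (1 - F x) 0} = {x | F x ≤ 1 - t} := by
      ext x
      simp only [Set.mem_ofPred_eq, le_max_iff, not_le.2 ht.1, or_false]
      exact le_sub_comm
    have ht' : 0 < 1 - t := by linarith [ht.2]
    simp only [h2, Measure.real]
    rw [volume_sublevel_of_homogeneous hd hF ht', ENNReal.toReal_mul,
      ENNReal.toReal_ofReal (by positivity)]
  have hp : (0 : ℝ) ≤ (n : ℝ) / d := by positivity
  rw [h1, integral_mul_const, ← intervalIntegral.integral_of_le zero_le_one,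
    intervalIntegral.integral_comp_sub_left (fun t : ℝ => t ^ ((n : ℝ) / d)) 1,
    integral_rpow (Or.inl (by linarith))]
  simp [Real.zero_rpow (show (n : ℝ) / d + 1 ≠ 0 by positivity)]

/-- If G x < s < F x, scaling x by s ^ (-1 / d) brings G below 1 and F above 1. -/
theorem le_of_homogeneous_sublevel {F G : EuclideanSpace ℝ (Fin n) → ℝ} (hd : d ≠ 0)
    (hF : ∀ t : ℝ, ∀ x, F (t • x) = t ^ d * F x) (hG : ∀ t : ℝ, ∀ x, G (t • x) = t ^ d * G x)
    {x : EuclideanSpace ℝ (Fin n)} (hG0 : 0 ≤ G x) (h : ∀ y, G y < 1 → F y ≤ 1) : F x ≤ G x := by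
  by_contra! hlt
  obtain ⟨s, hs1, hs2⟩ := exists_between hlt
  have hs : 0 < s := hG0.trans_lt hs1
  have hrd : (s ^ ((d : ℝ)⁻¹))⁻¹ ^ d = s⁻¹ := by
    rw [inv_pow, Real.rpow_inv_natCast_pow hs.le hd]
  have h1 := h ((s ^ ((d : ℝ)⁻¹))⁻¹ • x)
  rw [hF, hG, hrd, inv_mul_lt_iff₀ hs, inv_mul_le_iff₀ hs, mul_one] at h1
  exact absurd (h1 hs1) (not_le.2 hs2)

theorem le_of_homogeneous_superlevel {F G : EuclideanSpace ℝ (Fin n) → ℝ} (hd : d ≠ 0)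
    (hF : ∀ t : ℝ, ∀ x, F (t • x) = t ^ d * F x) (hG : ∀ t : ℝ, ∀ x, G (t • x) = t ^ d * G x)
    {x : EuclideanSpace ℝ (Fin n)} (hF0 : 0 ≤ F x) (h : ∀ y, 1 < G y → 1 ≤ F y) : G x ≤ F x :=
  le_of_homogeneous_sublevel hd hG hF hF0 fun y hy => by
    by_contra! hlt
    exact absurd (h y hlt) (not_le.2 hy)

/-! ### Comparison of volumes and the equality case -/

section Comparison

variable {F G : EuclideanSpace ℝ (Fin n) → ℝ}

theorem setIntegral_one_sub_le_integral_max (hFc : Continuous F)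
    (hF0 : ∀ x, 0 ≤ F x) (hFfin : volume {x | F x ≤ 1} ≠ ⊤)
    {B : Set (EuclideanSpace ℝ (Fin n))} (hB : IsCompact B) :
    ∫ x in B, (1 - F x) ≤ ∫ x, max (1 - F x) 0 := by
  have hi := integrable_max_one_sub hFc hF0 hFfin
  have h1 : IntegrableOn (fun x => 1 - F x) B :=
    (continuous_const.sub hFc).continuousOn.integrableOn_compact hB
  calc ∫ x in B, (1 - F x) ≤ ∫ x in B, max (1 - F x) 0 :=
        integral_mono h1 hi.integrableOn fun x => le_max_left _ _
    _ ≤ _ := setIntegral_le_integral hi (.of_forall fun x => le_max_right _ _)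

/-- The indicator of B times 1 - F lies below max(1 - F, 0), so equal integrals force equality
almost everywhere; continuity makes it pointwise on the open sets `interior B` and `Bᶜ`. -/
theorem eq_max_of_setIntegral_eq (hFc : Continuous F)
    (hF0 : ∀ x, 0 ≤ F x) (hFfin : volume {x | F x ≤ 1} ≠ ⊤)
    {B : Set (EuclideanSpace ℝ (Fin n))} (hB : IsCompact B)
    (h : ∫ x in B, (1 - F x) = ∫ x, max (1 - F x) 0) :
    (∀ x ∈ interior B, F x ≤ 1) ∧ ∀ x ∉ B, 1 ≤ F x := by
  have hi := integrable_max_one_sub hFc hF0 hFfin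
  have h1 : IntegrableOn (fun x => 1 - F x) B :=
    (continuous_const.sub hFc).continuousOn.integrableOn_compact hB
  rw [← integral_indicator hB.measurableSet, integral_eq_iff_of_ae_le
    ((integrable_indicator_iff hB.measurableSet).2 h1) hi] at h
  · constructor
    · have h2 : (fun x => 1 - F x) =ᵐ[volume.restrict (interior B)] fun x => max (1 - F x) 0 := by
        filter_upwards [ae_restrict_of_ae h, ae_restrict_mem isOpen_interior.measurableSet]
          with x hx hxB
        rw [← hx, Set.indicator_of_mem (interior_subset hxB)]
      have h3 := Measure.eqOn_open_of_ae_eq h2 isOpen_interior (by fun_prop) (by fun_prop)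
      intro x hx
      have := h3 hx
      simp only [left_eq_sup, sub_nonneg] at this
      exact this
    · have ho : IsOpen Bᶜ := hB.isClosed.isOpen_compl
      have h2 : (fun x => (0 : ℝ)) =ᵐ[volume.restrict Bᶜ] fun x => max (1 - F x) 0 := by
        filter_upwards [ae_restrict_of_ae h, ae_restrict_mem ho.measurableSet] with x hx hxB
        rw [← hx, Set.indicator_of_notMem hxB]
      have h3 := Measure.eqOn_open_of_ae_eq h2 ho (by fun_prop) (by fun_prop)
      intro x hx
      have := h3 hx
      simp only [right_eq_sup, sub_nonpos] at this
      exact this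
  · refine .of_forall fun x => ?_
    by_cases hx : x ∈ B <;> simp [hx]

/-- Among nonnegative homogeneous functions with a smaller integral over `{G ≤ 1}`, `G` has the
smallest sublevel set. -/
theorem volume_sublevel_le_of_setIntegral_le (hd : d ≠ 0)
    (hF : ∀ t : ℝ, ∀ x, F (t • x) = t ^ d * F x) (hG : ∀ t : ℝ, ∀ x, G (t • x) = t ^ d * G x)
    (hFc : Continuous F) (hGc : Continuous G) (hF0 : ∀ x, 0 ≤ F x) (hG0 : ∀ x, 0 ≤ G x)
    (hFfin : volume {x | F x ≤ 1} ≠ ⊤) (hB : IsCompact {x | G x ≤ 1})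
    (hle : ∫ x in {x | G x ≤ 1}, F x ≤ ∫ x in {x | G x ≤ 1}, G x) :
    volume.real {x | G x ≤ 1} ≤ volume.real {x | F x ≤ 1} ∧
      (volume.real {x | F x ≤ 1} = volume.real {x | G x ≤ 1} → F = G) := by
  have hGfin : volume {x | G x ≤ 1} ≠ ⊤ := hB.measure_ne_top
  have hq : 0 < 1 / ((n : ℝ) / d + 1) := by positivity
  have hFi : IntegrableOn F {x | G x ≤ 1} := hFc.continuousOn.integrableOn_compact hB
  have hGi : IntegrableOn G {x | G x ≤ 1} := hGc.continuousOn.integrableOn_compact hB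
  have h1i : IntegrableOn (fun _ => (1 : ℝ)) {x | G x ≤ 1} := integrableOn_const hGfin
  have hJF := integral_max_one_sub_of_homogeneous hd hF hFc hF0 hFfin
  have hJG := integral_max_one_sub_of_homogeneous hd hG hGc hG0 hGfin
  rw [max_one_sub_eq_indicator, integral_indicator hB.measurableSet] at hJG
  have h1 : ∫ x in {x | G x ≤ 1}, (1 - G x) ≤ ∫ x in {x | G x ≤ 1}, (1 - F x) := by
    rw [integral_sub h1i hGi, integral_sub h1i hFi]
    linarith
  have h2 := setIntegral_one_sub_le_integral_max hFc hF0 hFfin hB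
  refine ⟨le_of_mul_le_mul_left ?_ hq, fun heq => ?_⟩
  · rw [← hJF, ← hJG]
    exact h1.trans h2
  · rw [heq, ← hJG] at hJF
    obtain ⟨h3, h4⟩ := eq_max_of_setIntegral_eq hFc hF0 hFfin hB (le_antisymm h2 (hJF.trans_le h1))
    funext x
    refine le_antisymm (le_of_homogeneous_sublevel hd hF hG (hG0 x) fun y hy => h3 y ?_)
      (le_of_homogeneous_superlevel hd hF hG (hF0 x) fun y hy => h4 y (not_le.2 hy))
    exact interior_maximal (fun z (hz : G z < 1) => hz.le)
      (isOpen_lt hGc continuous_const) hy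

end Comparison

/-! ### Infinite volumes and the minimizer -/

theorem volume_sublevel_eq_top_of_neg {F : EuclideanSpace ℝ (Fin n) → ℝ} (hn : 1 ≤ n)
    (hF : ∀ t : ℝ, ∀ x, F (t • x) = t ^ d * F x) (hFc : Continuous F)
    {x : EuclideanSpace ℝ (Fin n)} (hx : F x < 0) : volume {x | F x ≤ 1} = ⊤ := by
  have ho : IsOpen {x | F x < 0} := isOpen_lt hFc continuous_const
  have hpos : 0 < volume {x | F x < 0} := ho.measure_pos _ ⟨x, hx⟩
  -- A nonempty open cone is invariant under doubling, so its volume equals 2 ^ n times itself and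
  -- must be infinite.
  have hs : {x | F x < 0} = (2 : ℝ) • {x | F x < 0} := by
    ext y
    rw [Set.mem_smul_set_iff_inv_smul_mem₀ two_ne_zero, Set.mem_ofPred_eq, Set.mem_ofPred_eq, hF]
    have h2 : (0 : ℝ) < 2⁻¹ ^ d := by positivity
    exact ⟨fun h => mul_neg_of_pos_of_neg h2 h, fun h => neg_of_mul_neg_right h h2.le⟩
  have h1 := congrArg volume hs
  rw [Measure.addHaar_smul_of_nonneg _ zero_le_two, finrank_euclideanSpace_fin] at h1
  have htop : volume {x | F x < 0} = ⊤ := by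
    by_contra hne
    have h2 : (1 : ENNReal) = ENNReal.ofReal (2 ^ n) := by
      rwa [eq_comm, ENNReal.mul_eq_right hpos.ne' hne, eq_comm] at h1
    rw [eq_comm, ENNReal.ofReal_eq_one] at h2
    exact absurd h2 (one_lt_pow₀ one_lt_two (by omega)).ne'
  exact top_le_iff.1 (htop ▸ measure_mono fun y (hy : F y < 0) => hy.le.trans zero_le_one)

theorem evalForm_smul_vector {f : MvPolynomial (Fin n) ℝ} (hf : f.IsHomogeneous d) (t : ℝ)
    (x : EuclideanSpace ℝ (Fin n)) : evalForm f (t • x) = t ^ d * evalForm f x := by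
  rw [evalForm_eq_sum_piAntidiag hf, evalForm_eq_sum_piAntidiag hf, Finset.mul_sum]
  refine Finset.sum_congr rfl fun k _ => ?_
  simp only [PiLp.smul_apply, smul_eq_mul, mul_pow, Finset.prod_mul_distrib]
  rw [Finset.prod_pow_eq_pow_sum, (Finset.mem_piAntidiag.1 k.2).1]
  ring

theorem continuous_evalForm (f : MvPolynomial (Fin n) ℝ) : Continuous (evalForm f) :=
  f.continuous_eval.comp (by fun_prop)

theorem evalForm_injective : Function.Injective (evalForm (n := n)) := fun _ _ h =>
  MvPolynomial.funext fun x => congrFun h (WithLp.toLp 2 x)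

theorem sublevel_normalizedEuclideanForm (hn : 1 ≤ n) (hm : m ≠ 0) :
    {x | evalForm (normalizedEuclideanForm (2 * m) n) x ≤ 1} =
      Metric.closedBall 0 ((sphereMoment n m)⁻¹ ^ (((2 * m : ℕ) : ℝ)⁻¹)) := by
  ext x
  have hc := sphereMoment_pos (m := m) hn
  rw [Set.mem_ofPred_eq, evalForm_normalizedEuclideanForm hn, mem_closedBall_zero_iff,
    Real.le_rpow_inv_iff_of_pos (norm_nonneg x) (inv_pos.2 hc).le (by positivity),
    Real.rpow_natCast, ← one_div, le_div_iff₀' hc]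

theorem sublevelVolume_normalizedEuclideanForm (hn : 1 ≤ n) (hm : m ≠ 0) :
    sublevelVolume (normalizedEuclideanForm (2 * m) n) =
      ENNReal.ofReal ((sphereMoment n m)⁻¹ ^ ((n : ℝ) / ((2 * m : ℕ) : ℝ)) *
        (Real.sqrt Real.pi ^ n / Real.Gamma ((n : ℝ) / 2 + 1))) := by
  have : Nonempty (Fin n) := ⟨⟨0, hn⟩⟩
  have hc := sphereMoment_pos (m := m) hn
  rw [sublevelVolume, sublevel_normalizedEuclideanForm hn hm, EuclideanSpace.volume_closedBall,
    Fintype.card_fin, ← ENNReal.ofReal_pow (by positivity), ← ENNReal.ofReal_mul (by positivity),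
    ← Real.rpow_mul_natCast (by positivity), inv_mul_eq_div]

theorem sublevelVolume_minimizer (hn : 1 ≤ n) (hm : m ≠ 0) {f : MvPolynomial (Fin n) ℝ}
    (hf : f.IsHomogeneous (2 * m)) (hf1 : nuclearNorm (2 * m) f ≤ 1) :
    sublevelVolume (normalizedEuclideanForm (2 * m) n) ≤ sublevelVolume f ∧
      (sublevelVolume f = sublevelVolume (normalizedEuclideanForm (2 * m) n) ↔
        f = normalizedEuclideanForm (2 * m) n) := by
  have hd : 2 * m ≠ 0 := by omega
  have hgfin : sublevelVolume (normalizedEuclideanForm (2 * m) n) ≠ ⊤ := by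
    rw [sublevelVolume_normalizedEuclideanForm hn hm]
    exact ENNReal.ofReal_ne_top
  by_cases hfin : sublevelVolume f = ⊤
  · refine ⟨hfin ▸ le_top, fun h => absurd (h ▸ hfin) hgfin, fun h => h ▸ rfl⟩
  · have hf0 : ∀ x, 0 ≤ evalForm f x := by
      intro x
      by_contra! hx
      exact hfin (volume_sublevel_eq_top_of_neg hn (evalForm_smul_vector hf)
        (continuous_evalForm f) hx)
    have hg0 : ∀ x, 0 ≤ evalForm (normalizedEuclideanForm (2 * m) n) x := by
      intro x
      rw [evalForm_normalizedEuclideanForm hn]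
      exact mul_nonneg (sphereMoment_pos hn).le (by positivity)
    -- This sublevel set is a centred ball, exactly where the integral comparison is available.
    have hB := sublevel_normalizedEuclideanForm hn hm
    obtain ⟨h1, h2⟩ := volume_sublevel_le_of_setIntegral_le hd (evalForm_smul_vector hf)
      (evalForm_smul_vector (isHomogeneous_normalizedEuclideanForm hn)) (continuous_evalForm f)
      (continuous_evalForm _) hf0 hg0 hfin (hB ▸ isCompact_closedBall _ _)
      (hB ▸ setIntegral_evalForm_le_normalizedEuclideanForm hn hf hf1 _)
    refine ⟨(ENNReal.toReal_le_toReal hgfin hfin).1 h1, fun h => ?_, fun h => h ▸ rfl⟩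
    exact evalForm_injective (h2 (congrArg ENNReal.toReal h))

theorem mainTheorem4 (n d : ℕ) (hn : 1 ≤ n) (hd : Even d) (hd0 : 0 < d) :
    -- the nuclear norm is an infimum over a nonempty set for every form of degree `d`
    (∀ f : MvPolynomial (Fin n) ℝ, f.IsHomogeneous d → (decompositionCosts d f).Nonempty) ∧
    -- `b / ‖b‖_*` is a form of degree `d` in the unit ball of the nuclear norm
    ((normalizedEuclideanForm d n).IsHomogeneous d ∧
      nuclearNorm d (normalizedEuclideanForm d n) ≤ 1) ∧
    -- the volume of its sublevel set
    sublevelVolume (normalizedEuclideanForm d n) =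
      ENNReal.ofReal
        ((∏ i ∈ Finset.range (d / 2), (2 * (i : ℝ) + n) / (2 * (i : ℝ) + 1)) ^ ((n : ℝ) / (d : ℝ))
          * (Real.sqrt Real.pi ^ n / Real.Gamma ((n : ℝ) / 2 + 1))) ∧
    volume (Metric.closedBall (0 : EuclideanSpace ℝ (Fin n)) 1) =
      ENNReal.ofReal (Real.sqrt Real.pi ^ n / Real.Gamma ((n : ℝ) / 2 + 1)) ∧
    -- it is the unique minimizer
    (∀ f : MvPolynomial (Fin n) ℝ, f.IsHomogeneous d → nuclearNorm d f ≤ 1 →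
      sublevelVolume (normalizedEuclideanForm d n) ≤ sublevelVolume f ∧
      (sublevelVolume f = sublevelVolume (normalizedEuclideanForm d n) ↔
        f = normalizedEuclideanForm d n)) := by
  obtain ⟨m, rfl⟩ := hd.two_dvd
  have hm : m ≠ 0 := by omega
  have : Nonempty (Fin n) := ⟨⟨0, hn⟩⟩
  refine ⟨fun f hf => decompositionCosts_nonempty hn hf,
    ⟨isHomogeneous_normalizedEuclideanForm hn, nuclearNorm_normalizedEuclideanForm_le hn⟩, ?_, ?_,
    fun f hf hf1 => sublevelVolume_minimizer hn hm hf hf1⟩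
  · rw [sublevelVolume_normalizedEuclideanForm hn hm, sphereMoment, ← Finset.prod_inv_distrib,
      Nat.mul_div_cancel_left _ two_pos]
    simp only [inv_div]
  · simp [EuclideanSpace.volume_closedBall]
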